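/- Let $P$ be a finite set of players and let $k\ge 1$ be an integer. For each player $p\in P$ let $S_p$ be a finite non-empty set of strategies, and let $u_p^1,\dots,u_p^k:\prod_{q\in P}S_q\to\mathbb{R}$ be payoff functions; these data form a (finite) min-$k$-game. A mixed strategy of player $p$ is a probability distribution $\sigma_p$ on $S_p$. A play $\sigma=\prod_{p\in P}\sigma_p$ is a choice of a mixed strategy for every player, regarded as the product distribution on $\prod_{p\in P}S_p$. The payoff to player $p$ from the play $\sigma$ is \[ \operatorname{pay}_p(\sigma)=\min\bigl\{\mathbb{E}[u_p^1(X)],\dots,\mathbb{E}[u_p^k(X)]\bigr\}, \] where $X$ is a random strategy profile with law $\sigma$. Then there is a play $\sigma$ that is an equilibrium: for every player $p\in P$ and every mixed strategy $\sigma_p'$ of $p$, \[ \operatorname{pay}_p(\sigma')\le\operatorname{pay}_p(\sigma), \] where $\sigma'$ is obtained from $\sigma$ by replacing $\sigma_p$ with $\sigma_p'$ and leaving the mixed strategies of all other players unchanged. -/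

import Mathlib

/-!
An equilibrium is a play against which no other play has positive total gain, the total gain being
the sum over the players of what each would earn by deviating alone. A minimum of expectations is
concave in a player's own mixed strategy, so total gain is concave in the deviation, and it vanishes
on the diagonal. By compactness it is enough to withstand finitely many deviations `ρ i`. Let
`φ i w` be the total gain of `ρ i` against the mixture of all of them with weights `w`. Then
`∑ i, w i * φ i w ≤ 0`, and the Gale–Nikaido–Debreu lemma yields `w` with all `φ i w` nonpositive.

This lemma holds because some `w` is such that, for every `i`, either `w i = 0` or `φ i w` is the
largest of the values `φ j w`, whence `φ j w ≤ ∑ i, w i * φ i w`. In place of Sperner's lemma for a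
triangulation, such a `w` is found with Scarf's lemma, a parity argument about finitely many points
ordered by finitely many rankings, applied to the points of a fine grid ranked by each coordinate.
-/

/-- A min-`k`-game with players `P`: every player `p` has a type `S p` of (pure) strategies and
`k` payoff functions `u p 0, …, u p (k - 1)` on the strategy profiles. -/
structure MinGame (P : Type*) (k : ℕ) where
  /-- The strategies of each player. -/
  S : P → Type*
  /-- The `k` payoff functions of each player. -/
  u : P → Fin k → (∀ q, S q) → ℝ

namespace MinGame

section

variable {P : Type*} [Fintype P] {k : ℕ} (G : MinGame P k) [∀ p, Fintype (G.S p)]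

/-- A mixed strategy of player `p` is a probability distribution on the finite set `S p`. -/
abbrev MixedStrategy (p : P) : Type _ := stdSimplex ℝ (G.S p)

/-- A play is given by a mixed strategy for each player; the corresponding product distribution
on strategy profiles is `MinGame.law`. -/
abbrev Play : Type _ := ∀ p, G.MixedStrategy p

variable {G} [DecidableEq P]

/-- The product distribution of a play: the joint law of independent random choices, the one of
player `p` having law `σ p`. -/
noncomputable def law (σ : G.Play) : stdSimplex ℝ (∀ p, G.S p) :=
  ⟨fun s => ∏ p, (σ p).1 (s p),
    fun s => Finset.prod_nonneg fun p _ => (σ p).2.1 (s p), by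
      rw [← Fintype.prod_sum fun p x => (σ p).1 x]
      exact Finset.prod_eq_one fun p _ => (σ p).2.2⟩

/-- The expectation of a function of the strategy profile under a play. -/
noncomputable def expectation (σ : G.Play) (f : (∀ p, G.S p) → ℝ) : ℝ :=
  ∑ s, (law σ).1 s * f s

/-- The payoff to player `p`: the minimum of her `k` expected payoffs. -/
noncomputable def payoff [NeZero k] (σ : G.Play) (p : P) : ℝ :=
  Finset.univ.inf' Finset.univ_nonempty fun i : Fin k => expectation σ (G.u p i)

/-- Player `p` tolerates `σ` if replacing her mixed strategy alone never raises her payoff. -/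
def Tolerates [NeZero k] (p : P) (σ : G.Play) : Prop :=
  ∀ τ : G.MixedStrategy p, payoff (Function.update σ p τ) p ≤ payoff σ p

/-- An equilibrium is a play tolerated by every player. -/
def IsEquilibrium [NeZero k] (σ : G.Play) : Prop :=
  ∀ p, Tolerates p σ

end

end MinGame

section DoubleCounting

open Finset

variable {A B : Type*}

theorem odd_card_filter_odd_card_bipartite_iff (s : Finset A) (t : Finset B) (R : A → B → Prop)
    [∀ a b, Decidable (R a b)] :
    Odd #{a ∈ s | Odd #(t.bipartiteAbove R a)} ↔ Odd #{b ∈ t | Odd #(s.bipartiteBelow R b)} := by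
  rw [← odd_sum_iff_odd_card_odd, ← odd_sum_iff_odd_card_odd,
    sum_card_bipartiteAbove_eq_sum_card_bipartiteBelow]

variable [DecidableEq A] [DecidableEq B]

theorem card_filter_image_erase_eq_two {f : A → B} {s : Finset A} {t : Finset B}
    (himage : s.image f = t) (hcard : #s = #t + 1) :
    #{x ∈ s | (s.erase x).image f = t} = 2 := by
  have hmaps : Set.MapsTo f s t := fun x hx => himage ▸ mem_image_of_mem f hx
  obtain ⟨x, hx, y, hy, hxy, hfxy⟩ := exists_ne_map_eq_of_card_lt_of_maps_to (by omega) hmaps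
  have image_erase_of_twin {x y : A} (hy : y ∈ s) (hxy : x ≠ y) (hfxy : f x = f y) :
      (s.erase x).image f = t := by
    refine subset_antisymm (himage ▸ image_subset_image (erase_subset x s)) fun b hb => ?_
    obtain ⟨z, hz, rfl⟩ := mem_image.1 (himage ▸ hb)
    by_cases hzx : z = x
    · exact mem_image.2 ⟨y, mem_erase.2 ⟨hxy.symm, hy⟩, by rw [hzx, hfxy]⟩
    · exact mem_image_of_mem f (mem_erase.2 ⟨hzx, hz⟩)
  suffices {x ∈ s | (s.erase x).image f = t} = {x, y} by rw [this, card_pair hxy]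
  ext z
  simp only [mem_filter, mem_insert, mem_singleton]
  constructor
  · rintro ⟨hz, hzimage⟩
    by_contra! hne
    have hinj : Set.InjOn f (s.erase z) := injOn_of_card_image_eq (by
      rw [hzimage, card_erase_of_mem hz, hcard, Nat.add_sub_cancel])
    exact hxy (hinj (by simp [hx, hne.1.symm]) (by simp [hy, hne.2.symm]) hfxy)
  · rintro (rfl | rfl)
    · exact ⟨hx, image_erase_of_twin hy hxy hfxy⟩
    · exact ⟨hy, image_erase_of_twin hx hxy.symm hfxy.symm⟩

theorem card_filter_image_erase_eq_one {f : A → B} {s : Finset A} {t : Finset B}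
    (himage : s.image f = t) (hcard : #s = #t) {b : B} (hb : b ∈ t) :
    #{x ∈ s | (s.erase x).image f = t.erase b} = 1 := by
  have hinj : Set.InjOn f s := injOn_of_card_image_eq (by rw [himage, hcard])
  have image_erase {z : A} (hz : z ∈ s) : (s.erase z).image f = t.erase (f z) := by
    rw [← sdiff_singleton_eq_erase, image_sdiff_of_injOn hinj (by simpa), image_singleton,
      sdiff_singleton_eq_erase, himage]
  obtain ⟨x, hx, rfl⟩ := mem_image.1 (himage ▸ hb)
  refine card_eq_one.2 ⟨x, ?_⟩
  ext z
  simp only [mem_filter, mem_singleton]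
  constructor
  · rintro ⟨hz, hzimage⟩
    rw [image_erase hz, eq_comm, erase_inj _ hb] at hzimage
    exact (hinj hx hz hzimage).symm
  · rintro rfl
    exact ⟨hx, image_erase hx⟩

theorem odd_card_filter_image_erase_iff {f : A → B} {s : Finset A} {t : Finset B}
    (himage : s.image f ⊆ t) (hcard : #s = #t) {b : B} (hb : b ∈ t) :
    Odd #{x ∈ s | (s.erase x).image f = t.erase b} ↔ s.image f = t := by
  refine ⟨fun hodd => ?_, fun h => card_filter_image_erase_eq_one h hcard hb ▸ odd_one⟩
  obtain ⟨x, hx⟩ := card_pos.1 hodd.pos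
  obtain ⟨hxs, hxb⟩ := mem_filter.1 hx
  have himage_insert : s.image f = insert (f x) (t.erase b) := by
    rw [← hxb, ← image_insert, insert_erase hxs]
  by_cases hfx : f x = b
  · rw [himage_insert, hfx, insert_erase hb]
  · have hfxt : f x ∈ t.erase b := mem_erase.2 ⟨hfx, himage (mem_image_of_mem f hxs)⟩
    rw [insert_eq_of_mem hfxt] at himage_insert
    rw [card_filter_image_erase_eq_two himage_insert
      (by rw [hcard, card_erase_add_one hb])] at hodd
    exact absurd even_two (Nat.not_even_iff_odd.2 hodd)

theorem card_filter_covBy_eq_card_filter_insert [Fintype A] (p : Finset A → Prop)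
    [DecidablePred p] (s : Finset A) [DecidablePred (s ⋖ ·)] :
    #{t | p t ∧ s ⋖ t} = #{a | a ∉ s ∧ p (insert a s)} := by
  have hinj : Set.InjOn (insert · s) ({a | a ∉ s ∧ p (insert a s)} : Finset A) :=
    s.insert_inj_on.mono fun a ha => (mem_filter_univ a).1 ha |>.1
  rw [← card_image_of_injOn hinj]
  congr 1
  ext t
  simp only [covBy_iff_exists_insert, mem_filter_univ, mem_image]
  constructor
  · rintro ⟨hp, a, ha, rfl⟩
    exact ⟨a, ⟨ha, hp⟩, rfl⟩
  · rintro ⟨a, ⟨ha, hp⟩, rfl⟩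
    exact ⟨hp, a, ha, rfl⟩

theorem card_filter_covBy_eq_card_filter_erase [Fintype A] (p : Finset A → Prop)
    [DecidablePred p] (t : Finset A) [DecidablePred (· ⋖ t)] :
    #{s | p s ∧ s ⋖ t} = #{a ∈ t | p (t.erase a)} := by
  have hinj : Set.InjOn t.erase ({a ∈ t | p (t.erase a)} : Finset A) :=
    t.erase_injOn.mono fun a ha => (mem_filter.1 ha).1
  rw [← card_image_of_injOn hinj]
  congr 1
  ext s
  simp only [covBy_iff_exists_erase, mem_filter, mem_univ, true_and, mem_image]
  constructor
  · rintro ⟨hp, a, ha, rfl⟩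
    exact ⟨a, ⟨ha, hp⟩, rfl⟩
  · rintro ⟨a, ⟨ha, hp⟩, rfl⟩
    exact ⟨hp, a, ha, rfl⟩

end DoubleCounting

namespace Scarf

open Finset

variable {V I α : Type*}

/-- For rankings `r i` of `V`, the point `x` ranks, for each `i ∈ C`, strictly above the lowest
point of `σ`. -/
def Exceeds [LT α] (r : I → V → α) (σ : Finset V) (C : Finset I) (x : V) : Prop :=
  ∀ i ∈ C, ∃ y ∈ σ, r i y < r i x

/-- Scarf's dominant pairs, which play the role of the simplices of a triangulation: no point
exceeds `σ` for all the rankings in `C` at once. -/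
def IsDominant [LT α] (r : I → V → α) (σ : Finset V) (C : Finset I) : Prop :=
  ∀ x, ¬ Exceeds r σ C x

section Exchange

variable [LinearOrder α] {r : I → V → α} {σ τ : Finset V} {C D : Finset I} {x : V}

theorem not_exceeds_iff : ¬ Exceeds r σ C x ↔ ∃ i ∈ C, ∀ y ∈ σ, r i x ≤ r i y := by
  simp only [Exceeds, not_forall, not_exists, not_and, not_lt, exists_prop]

theorem Exceeds.mono (h : Exceeds r σ C x) (hστ : σ ⊆ τ) (hDC : D ⊆ C) : Exceeds r τ D x :=
  fun i hi => (h i (hDC hi)).imp fun _ hy => hy.imp_left (@hστ _)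

theorem IsDominant.mono (h : IsDominant r τ D) (hστ : σ ⊆ τ) (hDC : D ⊆ C) : IsDominant r σ C :=
  fun x hx => h x (hx.mono hστ hDC)

/-- The lowest point of `σ` for the ranking `r i`. -/
noncomputable def lowest (r : I → V → α) (hσ : σ.Nonempty) (i : I) : V :=
  (σ.exists_min_image (r i) hσ).choose

theorem lowest_mem (hσ : σ.Nonempty) (i : I) : lowest r hσ i ∈ σ :=
  (σ.exists_min_image (r i) hσ).choose_spec.1

theorem lowest_le (hσ : σ.Nonempty) (i : I) {y : V} (hy : y ∈ σ) : r i (lowest r hσ i) ≤ r i y :=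
  (σ.exists_min_image (r i) hσ).choose_spec.2 y hy

theorem image_lowest_eq_iff [DecidableEq V] (hr : ∀ i, (r i).Injective) (hσ : σ.Nonempty) :
    C.image (lowest r hσ) = σ ↔ ∀ x ∈ σ, ¬ Exceeds r σ C x := by
  have hsub : C.image (lowest r hσ) ⊆ σ := image_subset_iff.2 fun i _ => lowest_mem hσ i
  rw [← hsub.ge_iff_eq]
  refine forall₂_congr fun x hx => ?_
  rw [not_exceeds_iff, mem_image]
  refine exists_congr fun i => and_congr_right fun _ => ⟨fun h y hy => ?_, fun h => ?_⟩
  · exact h ▸ lowest_le hσ i hy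
  · exact hr i ((lowest_le hσ i hx).antisymm (h _ (lowest_mem hσ i)))

variable [DecidableEq I] {k l : I} {w w' : V ⊕ I}

open Classical in
/-- The rankings `k ∈ C` without which every point of `σ` is still lowest in `σ` for some ranking
in `C`. -/
noncomputable def critical (r : I → V → α) (σ : Finset V) (C : Finset I) : Finset I :=
  {k ∈ C | ∀ x ∈ σ, ¬ Exceeds r σ (C.erase k) x}

theorem mem_critical :
    k ∈ critical r σ C ↔ k ∈ C ∧ ∀ x ∈ σ, ¬ Exceeds r σ (C.erase k) x := by
  simp only [critical, mem_filter]

theorem IsDominant.odd_card_critical_iff (hr : ∀ i, (r i).Injective) (h : IsDominant r σ C)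
    (hcard : #C = #σ + 1) : Odd #(critical r σ C) ↔ σ = ∅ := by
  classical
  rcases σ.eq_empty_or_nonempty with rfl | hσ
  · simp [critical, hcard]
  · have himage : C.image (lowest r hσ) = σ := (image_lowest_eq_iff hr hσ).2 fun x _ => h x
    have htwo : #(critical r σ C) = 2 := by
      simp only [critical, ← image_lowest_eq_iff hr hσ]
      convert card_filter_image_erase_eq_two himage hcard
    simp [htwo, hσ.ne_empty, Nat.not_odd_iff_even.2 even_two]

/-- The exchange step along `k`: a point that is highest for `r k` among those exceeding `σ` for
the other rankings in `C` enters `σ`, or, when there is none, `k` leaves `C`. -/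
def IsPivot (r : I → V → α) (σ : Finset V) (C : Finset I) (k : I) : V ⊕ I → Prop
  | .inl x => Exceeds r σ (C.erase k) x ∧ ∀ y, Exceeds r σ (C.erase k) y → r k y ≤ r k x
  | .inr j => j = k ∧ IsDominant r σ (C.erase k)

theorem exists_isPivot [Finite V] (r : I → V → α) (σ : Finset V) (C : Finset I) (k : I) :
    ∃ w, IsPivot r σ C k w := by
  by_cases h : IsDominant r σ (C.erase k)
  · exact ⟨.inr k, rfl, h⟩
  · obtain ⟨x, hx⟩ := not_forall_not.1 h
    obtain ⟨z, hz, hmax⟩ :=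
      {y | Exceeds r σ (C.erase k) y}.exists_max_image (r k) (Set.toFinite _) ⟨x, hx⟩
    exact ⟨.inl z, hz, hmax⟩

theorem IsPivot.eq (hr : (r k).Injective) (hw : IsPivot r σ C k w) (hw' : IsPivot r σ C k w') :
    w = w' := by
  rcases w with x | j <;> rcases w' with y | j'
  · rw [hr ((hw'.2 x hw.1).antisymm (hw.2 y hw'.1))]
  · exact absurd hw.1 (hw'.2 x)
  · exact absurd hw'.1 (hw.2 y)
  · rw [hw.1, hw'.1]

theorem IsDominant.eq_of_isPivot (h : IsDominant r σ C) (hk : IsPivot r σ C k w)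
    (hl : IsPivot r σ C l w) : k = l := by
  rcases w with x | j
  · by_contra hkl
    refine h x fun i hi => ?_
    by_cases hik : i = k
    · exact hl.1 i (mem_erase.2 ⟨hik ▸ hkl, hi⟩)
    · exact hk.1 i (mem_erase.2 ⟨hik, hi⟩)
  · exact hk.1.symm.trans hl.1

theorem IsDominant.insert_of_isPivot [DecidableEq V] (h : IsDominant r σ C)
    (hx : IsPivot r σ C k (.inl x)) :
    IsDominant r (insert x σ) C := by
  intro y hy
  have hyσ : Exceeds r σ (C.erase k) y := fun i hi => by
    obtain ⟨z, hz, hzy⟩ := hy i (mem_of_mem_erase hi)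
    rcases mem_insert.1 hz with rfl | hz
    · exact (hx.1 i hi).imp fun _ => And.imp_right hzy.trans'
    · exact ⟨z, hz, hzy⟩
  refine h x fun i hi => ?_
  by_cases hik : i = k
  · subst hik
    obtain ⟨z, hz, hzy⟩ := hy i hi
    have hzx : r i z < r i x := hzy.trans_le (hx.2 y hyσ)
    exact ⟨z, mem_of_mem_insert_of_ne hz fun h => hzx.ne (h ▸ rfl), hzx⟩
  · exact hx.1 i (mem_erase.2 ⟨hik, hi⟩)

theorem exists_isPivot_of_isDominant_insert [DecidableEq V]
    (hr : ∀ i, (r i).Injective) (hx : x ∉ σ) (h : IsDominant r (insert x σ) C)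
    (hcard : #C = #σ + 1) :
    ∃ k ∈ critical r σ C, IsPivot r σ C k (.inl x) := by
  have hne : (insert x σ).Nonempty := insert_nonempty x σ
  set m := lowest r hne
  have himage : C.image m = insert x σ := (image_lowest_eq_iff hr hne).2 fun y _ => h y
  have hinj : Set.InjOn m C :=
    injOn_of_card_image_eq (by rw [himage, card_insert_of_notMem hx, hcard])
  obtain ⟨k, hk, hkx⟩ := mem_image.1 (himage ▸ mem_insert_self x σ)
  refine ⟨k, mem_critical.2 ⟨hk, fun e he => not_exceeds_iff.2 ?_⟩, fun i hi => ?_, fun y hy => ?_⟩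
  · obtain ⟨i, hi, rfl⟩ := mem_image.1 (himage ▸ mem_insert_of_mem he)
    have hik : i ≠ k := fun hik => hx (hkx ▸ hik ▸ he)
    exact ⟨i, mem_erase.2 ⟨hik, hi⟩, fun y hy => lowest_le hne i (mem_insert_of_mem hy)⟩
  · obtain ⟨hik, hi⟩ := mem_erase.1 hi
    have hmi : m i ≠ x := fun hmi => hik (hinj hi hk (hmi.trans hkx.symm))
    exact ⟨m i, mem_of_mem_insert_of_ne (lowest_mem hne i) hmi,
      (lowest_le hne i (mem_insert_self x σ)).lt_of_ne fun h => hmi (hr i h)⟩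
  · obtain ⟨i, hi, hiy⟩ := not_exceeds_iff.1 (h y)
    by_cases hik : i = k
    · exact hik ▸ hiy x (mem_insert_self x σ)
    · obtain ⟨z, hz, hzy⟩ := hy i (mem_erase.2 ⟨hik, hi⟩)
      exact absurd (hiy z (mem_insert_of_mem hz)) hzy.not_ge

end Exchange

section Parity

variable [LinearOrder α] [Fintype I] [DecidableEq I] {r : I → V → α}
  {T R : Finset (V ⊕ I)} {w : V ⊕ I}

/-- A dominant pair `(σ, C)` encoded as the single set `σ ∪ Cᶜ`, so that passing to a larger `σ`
and passing to a smaller `C` both become insertions. -/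
def IsCell (r : I → V → α) (T : Finset (V ⊕ I)) : Prop :=
  IsDominant r T.toLeft T.toRightᶜ

theorem IsCell.mono (h : IsCell r R) (hTR : T ⊆ R) : IsCell r T :=
  IsDominant.mono h (toLeft_subset_toLeft hTR) (compl_subset_compl.2 (toRight_subset_toRight hTR))

theorem card_compl_toRight (hcard : #T + 1 = Fintype.card I) : #T.toRightᶜ = #T.toLeft + 1 := by
  have := T.card_toLeft_add_card_toRight
  rw [card_compl]
  omega

theorem IsCell.insert_iff [DecidableEq V] (hr : ∀ i, (r i).Injective)
    (h : IsCell r T) (hcard : #T + 1 = Fintype.card I) : w ∉ T ∧ IsCell r (insert w T) ↔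
      ∃ k ∈ critical r T.toLeft T.toRightᶜ, IsPivot r T.toLeft T.toRightᶜ k w := by
  rcases w with x | j
  · rw [IsCell, toLeft_insert_inl, toRight_insert_inl, ← mem_toLeft]
    constructor
    · rintro ⟨hx, hdom⟩
      exact exists_isPivot_of_isDominant_insert hr hx hdom (card_compl_toRight hcard)
    · rintro ⟨k, hk, hx⟩
      exact ⟨fun hxT => (mem_critical.1 hk).2 x hxT hx.1, IsDominant.insert_of_isPivot h hx⟩
  · rw [IsCell, toLeft_insert_inr, toRight_insert_inr, ← mem_toRight, compl_insert]
    constructor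
    · rintro ⟨hj, hdom⟩
      exact ⟨j, mem_critical.2 ⟨mem_compl.2 hj, fun x _ => hdom x⟩, rfl, hdom⟩
    · rintro ⟨k, hk, rfl, hdom⟩
      exact ⟨mem_compl.1 (mem_critical.1 hk).1, hdom⟩

/-- A door of type `i₀`: a cell one element short of the number of rankings whose elements, with
`v : V` coloured `c v` and `i : I` coloured `i`, carry exactly the colours other than `i₀`. -/
def IsDoor (r : I → V → α) (c : V → I) (i₀ : I) (T : Finset (V ⊕ I)) : Prop :=
  IsCell r T ∧ T.image (Sum.elim c id) = univ.erase i₀ ∧ #T + 1 = Fintype.card I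

/-- A room: a cell with as many elements as there are rankings. -/
def IsRoom (r : I → V → α) (R : Finset (V ⊕ I)) : Prop :=
  IsCell r R ∧ #R = Fintype.card I

variable {c : V → I} {i₀ : I}

theorem isDoor_map_inr (r : I → V → α) (c : V → I) (i₀ : I) :
    IsDoor r c i₀ ((univ.erase i₀).map .inr) := by
  refine ⟨fun x hx => ?_, ?_, ?_⟩
  · obtain ⟨y, hy, -⟩ := hx i₀ (by simp)
    simp at hy
  · ext i
    simp
  · rw [card_map, card_erase_add_one (mem_univ i₀), card_univ]

theorem IsDoor.toLeft_eq_empty_iff (h : IsDoor r c i₀ T) :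
    T.toLeft = ∅ ↔ T = (univ.erase i₀).map .inr := by
  refine ⟨fun hT => ?_, fun hT => by ext; simp [hT]⟩
  obtain ⟨D, rfl⟩ : ∃ D : Finset I, T = D.map .inr :=
    ⟨T.toRight, by rw [← empty_disjSum, ← hT, toLeft_disjSum_toRight]⟩
  have himage : (D.map .inr).image (Sum.elim c id) = D := by ext; simp
  rw [← h.2.1, himage]

open Classical in
theorem IsCell.card_extensions [Fintype V] (hr : ∀ i, (r i).Injective) (h : IsCell r T)
    (hcard : #T + 1 = Fintype.card I) :
    #{w | w ∉ T ∧ IsCell r (insert w T)} = #(critical r T.toLeft T.toRightᶜ) := by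
  choose pivot hpivot using exists_isPivot r T.toLeft T.toRightᶜ
  have hinj : pivot.Injective := fun k l hkl =>
    IsDominant.eq_of_isPivot h (hpivot k) (hkl ▸ hpivot l)
  rw [← card_image_of_injective _ hinj]
  congr 1
  ext w
  rw [mem_filter_univ, h.insert_iff hr hcard, mem_image]
  exact exists_congr fun k => and_congr_right fun _ =>
    ⟨fun hw => (hpivot k).eq (hr k) hw, fun hw => hw ▸ hpivot k⟩

open Classical in
theorem IsDoor.odd_card_rooms_iff [Fintype V] (hr : ∀ i, (r i).Injective) (h : IsDoor r c i₀ T) :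
    Odd #{R | IsRoom r R ∧ T ⋖ R} ↔ T = (univ.erase i₀).map .inr := by
  have hrooms : #{R | IsRoom r R ∧ T ⋖ R} = #(critical r T.toLeft T.toRightᶜ) := by
    rw [card_filter_covBy_eq_card_filter_insert, ← h.1.card_extensions hr h.2.2]
    congr 1
    ext w
    simp only [mem_filter_univ]
    exact and_congr_right fun hw => and_iff_left (by rw [card_insert_of_notMem hw, h.2.2])
  rw [hrooms, IsDominant.odd_card_critical_iff hr h.1 (card_compl_toRight h.2.2),
    h.toLeft_eq_empty_iff]

open Classical in
theorem IsRoom.odd_card_doors_iff [Fintype V] (c : V → I) (i₀ : I) (h : IsRoom r R) :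
    Odd #{T | IsDoor r c i₀ T ∧ T ⋖ R} ↔ R.image (Sum.elim c id) = univ := by
  rw [card_filter_covBy_eq_card_filter_erase, ← odd_card_filter_image_erase_iff (subset_univ _)
    (h.2.trans card_univ.symm) (mem_univ i₀)]
  congr! 4 with w hw
  exact ⟨fun hd => hd.2.1, fun hd =>
    ⟨h.1.mono (erase_subset w R), hd, by rw [card_erase_add_one hw, h.2]⟩⟩

/-- Only the door without points opens to an odd number of rooms, so by double counting some room
has an odd number of doors. -/
theorem exists_isRoom_image_eq_univ [Finite V] [Nonempty I] (hr : ∀ i, (r i).Injective)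
    (c : V → I) :
    ∃ R, IsRoom r R ∧ R.image (Sum.elim c id) = univ := by
  classical
  cases nonempty_fintype V
  obtain ⟨i₀⟩ := ‹Nonempty I›
  have hdoors : ({T ∈ {T | IsDoor r c i₀ T} | Odd #(bipartiteAbove (· ⋖ ·) {R | IsRoom r R} T)} :
      Finset (Finset (V ⊕ I))) = {(univ.erase i₀).map .inr} := by
    ext T
    simp only [bipartiteAbove, filter_filter, mem_filter_univ, mem_singleton]
    exact ⟨fun h => (h.1.odd_card_rooms_iff hr).1 h.2, fun h =>
      have hT : IsDoor r c i₀ T := h ▸ isDoor_map_inr r c i₀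
      ⟨hT, (hT.odd_card_rooms_iff hr).2 h⟩⟩
  have hrooms := (odd_card_filter_odd_card_bipartite_iff _ _ _).1
    (hdoors ▸ card_singleton _ ▸ odd_one)
  obtain ⟨R, hR⟩ := card_pos.1 hrooms.pos
  simp only [bipartiteBelow, filter_filter, mem_filter_univ] at hR
  exact ⟨R, hR.1, (hR.1.odd_card_doors_iff c i₀).1 hR.2⟩

end Parity

/-- **Scarf's lemma**. Ties are broken by an arbitrary enumeration of `V`. -/
theorem exists_isDominant_image [Finite V] [Nonempty V] [Finite I] [LinearOrder α] [DecidableEq I]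
    (f : I → V → α) (c : V → I) : ∃ σ : Finset V, IsDominant f σ (σ.image c) := by
  cases nonempty_fintype V
  cases nonempty_fintype I
  have : Nonempty I := ‹Nonempty V›.map c
  let r : I → V → α ×ₗ Fin (Fintype.card V) := fun i v => toLex (f i v, Fintype.equivFin V v)
  have hr : ∀ i, (r i).Injective := fun i v w h =>
    (Fintype.equivFin V).injective (congrArg (fun z => (ofLex z).2) h)
  obtain ⟨R, ⟨hdom, -⟩, himage⟩ := exists_isRoom_image_eq_univ hr c
  have hcolours : R.toRightᶜ ⊆ R.toLeft.image c := fun i hi => by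
    obtain ⟨v | j, hw, rfl⟩ := mem_image.1 (himage ▸ mem_univ i)
    · exact mem_image_of_mem c (mem_toLeft.2 hw)
    · exact absurd (mem_toRight.2 hw) (mem_compl.1 hi)
  refine ⟨R.toLeft, fun x hx => hdom x fun i hi => ?_⟩
  exact (hx i (hcolours hi)).imp fun _ =>
    And.imp_right fun h => Prod.Lex.toLex_lt_toLex.2 (.inl h)

end Scarf

/-- The grid of mesh `1 / N` in the standard simplex, with coordinates multiplied by `N` so as to be
natural numbers. -/
abbrev SimplexGrid (I : Type*) [Fintype I] [DecidableEq I] (N : ℕ) : Type _ :=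
  Finset.piAntidiag (Finset.univ : Finset I) N

namespace SimplexGrid

open Finset

variable {I : Type*} [Fintype I] [DecidableEq I] {N : ℕ}

theorem sum_eq (t : SimplexGrid I N) : ∑ i, t.1 i = N :=
  (mem_piAntidiag.1 t.2).1

/-- The grid point with coordinates `t i`. -/
def mk (t : I → ℕ) (ht : ∑ i, t i = N) : SimplexGrid I N :=
  ⟨t, mem_piAntidiag.2 ⟨ht, fun i _ => mem_univ i⟩⟩

instance [Nonempty I] : Nonempty (SimplexGrid I N) :=
  ‹Nonempty I›.map fun i => mk (Pi.single i N) (by simp)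

/-- Otherwise some grid point has all its coordinates larger than those of `μ`, and exceeds `σ`. -/
theorem lt_sum_add_card_of_isDominant [Nonempty I] {σ : Finset (SimplexGrid I N)} {C : Finset I}
    (h : Scarf.IsDominant (fun i t => t.1 i) σ C) {μ : I → ℕ}
    (hμ : ∀ i ∈ C, ∃ t ∈ σ, t.1 i ≤ μ i) : N < ∑ i, μ i + Fintype.card I := by
  by_contra! hle
  obtain ⟨i₀⟩ := ‹Nonempty I›
  let x : I → ℕ := μ + 1 + Pi.single i₀ (N - (∑ i, μ i + Fintype.card I))
  have hx : ∑ i, x i = N := by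
    simp only [x, Pi.add_apply, Pi.one_apply, sum_add_distrib, sum_const, card_univ, smul_eq_mul,
      mul_one, sum_pi_single', mem_univ, if_true]
    omega
  refine h (mk x hx) fun i hi => (hμ i hi).imp fun t ht => ht.imp_right fun hti => ?_
  exact (Nat.lt_succ_of_le hti).trans_le (Nat.le_add_right _ _)

theorem apply_lt_add_card_of_isDominant {σ : Finset (SimplexGrid I N)} {C : Finset I}
    (h : Scarf.IsDominant (fun i t => t.1 i) σ C) {μ : I → ℕ}
    (hμ : ∀ i ∈ C, ∃ t ∈ σ, t.1 i ≤ μ i) {t : SimplexGrid I N} (ht : μ ≤ t.1) (j : I) :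
    t.1 j < μ j + Fintype.card I := by
  have : Nonempty I := ⟨j⟩
  have hN := lt_sum_add_card_of_isDominant h hμ
  have hrest : ∑ i ∈ univ.erase j, μ i ≤ ∑ i ∈ univ.erase j, t.1 i := sum_le_sum fun i _ => ht i
  have ht_sum := t.sum_eq
  rw [← add_sum_erase _ _ (mem_univ j)] at ht_sum hN
  omega

theorem exists_near_all_labels [Nonempty I] (c : SimplexGrid I N → I) :
    ∃ t : SimplexGrid I N, ∀ i, t.1 i < Fintype.card I ∨
      ∃ t' : SimplexGrid I N, c t' = i ∧ ∀ j, |(t.1 j : ℤ) - t'.1 j| < Fintype.card I := by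
  obtain ⟨σ, hdom⟩ := Scarf.exists_isDominant_image (fun i (t : SimplexGrid I N) => t.1 i) c
  have hσ : σ.Nonempty := by
    rw [nonempty_iff_ne_empty]
    rintro rfl
    exact hdom (Classical.arbitrary _) (by simp [Scarf.Exceeds])
  let μ : I → ℕ := fun i => if i ∈ σ.image c then σ.inf' hσ (fun t => t.1 i) else 0
  have hμ : ∀ i ∈ σ.image c, ∃ t ∈ σ, t.1 i ≤ μ i := fun i hi => by
    obtain ⟨t, ht, hti⟩ := σ.exists_mem_eq_inf' hσ (fun t => t.1 i)
    exact ⟨t, ht, by simp only [μ, if_pos hi, hti, le_refl]⟩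
  have hμ_le : ∀ t ∈ σ, μ ≤ t.1 := fun t ht i => by
    simp only [μ]
    split_ifs
    exacts [inf'_le _ ht, Nat.zero_le _]
  have hlt : ∀ t ∈ σ, ∀ j, t.1 j < μ j + Fintype.card I := fun t ht =>
    apply_lt_add_card_of_isDominant hdom hμ (hμ_le t ht)
  obtain ⟨t, ht⟩ := hσ
  refine ⟨t, fun i => ?_⟩
  by_cases hi : i ∈ σ.image c
  · obtain ⟨t', ht', rfl⟩ := mem_image.1 hi
    refine .inr ⟨t', rfl, fun j => abs_lt.2 ?_⟩
    have := hlt t ht j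
    have := hlt t' ht' j
    have : μ j ≤ t.1 j := hμ_le t ht j
    have : μ j ≤ t'.1 j := hμ_le t' ht' j
    omega
  · exact .inl (by simpa [μ, hi] using hlt t ht i)

/-- The point of the standard simplex represented by a grid point. -/
noncomputable def toStdSimplex (hN : N ≠ 0) (t : SimplexGrid I N) : stdSimplex ℝ I :=
  ⟨fun i => t.1 i / N, fun i => by positivity, by
    rw [← sum_div, ← Nat.cast_sum, t.sum_eq, div_self (Nat.cast_ne_zero.2 hN)]⟩

theorem toStdSimplex_apply (hN : N ≠ 0) (t : SimplexGrid I N) (i : I) :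
    t.toStdSimplex hN i = t.1 i / N :=
  rfl

theorem dist_toStdSimplex_le (hN : N ≠ 0) {t t' : SimplexGrid I N} {n : ℕ}
    (h : ∀ j, |(t.1 j : ℤ) - t'.1 j| ≤ n) :
    dist (t.toStdSimplex hN) (t'.toStdSimplex hN) ≤ n / N := by
  rw [Subtype.dist_eq, dist_pi_le_iff (by positivity)]
  intro j
  change dist ((t.1 j : ℝ) / N) (t'.1 j / N) ≤ n / N
  rw [Real.dist_eq, ← sub_div, abs_div, Nat.abs_cast]
  gcongr
  exact_mod_cast h j

end SimplexGrid

section Covering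

open Filter Topology

variable {I : Type*} [Fintype I]

theorem continuous_stdSimplex_apply (i : I) : Continuous fun x : stdSimplex ℝ I => x i :=
  (continuous_apply i).comp continuous_subtype_val

variable [Nonempty I]

theorem exists_near_all_of_cover {F : I → Set (stdSimplex ℝ I)} (hF : ∀ x, ∃ i, x ∈ F i)
    {ε : ℝ} (hε : 0 < ε) : ∃ x : stdSimplex ℝ I, ∀ i, x i ≤ ε ∨ ∃ y ∈ F i, dist x y ≤ ε := by
  classical
  obtain ⟨N, hN⟩ := exists_nat_gt (Fintype.card I / ε)
  have hN₀ : (0 : ℝ) < N := lt_of_le_of_lt (by positivity) hN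
  have hmesh : (Fintype.card I : ℝ) / N ≤ ε := ((div_lt_comm₀ hε hN₀).1 hN).le
  have hN' : N ≠ 0 := Nat.cast_ne_zero.1 hN₀.ne'
  choose c hc using fun t : SimplexGrid I N => hF (t.toStdSimplex hN')
  obtain ⟨t, ht⟩ := SimplexGrid.exists_near_all_labels c
  refine ⟨t.toStdSimplex hN', fun i => (ht i).imp (fun hi => ?_) ?_⟩
  · rw [SimplexGrid.toStdSimplex_apply]
    exact hmesh.trans' (by gcongr)
  · rintro ⟨t', rfl, hnear⟩
    exact ⟨_, hc t', hmesh.trans' (SimplexGrid.dist_toStdSimplex_le hN' fun j => (hnear j).le)⟩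

theorem exists_forall_eq_zero_or_mem_of_isClosed_cover {F : I → Set (stdSimplex ℝ I)}
    (hclosed : ∀ i, IsClosed (F i)) (hcover : ∀ x, ∃ i, x ∈ F i) :
    ∃ x : stdSimplex ℝ I, ∀ i, x i = 0 ∨ x ∈ F i := by
  choose x hx using fun n : ℕ => exists_near_all_of_cover hcover (Nat.one_div_pos_of_nat (n := n))
  obtain ⟨z, n, hn, hz⟩ := CompactSpace.tendsto_subseq x
  have hε : Tendsto (fun m => 1 / ((n m : ℝ) + 1)) atTop (𝓝 0) :=
    tendsto_one_div_add_atTop_nhds_zero_nat.comp hn.tendsto_atTop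
  refine ⟨z, fun i => or_iff_not_imp_left.2 fun hzi => Metric.mem_of_closed' (hclosed i) |>.2 ?_⟩
  intro δ hδ
  have hpos : ∀ᶠ m in atTop, 1 / ((n m : ℝ) + 1) < x (n m) i :=
    hε.eventually_lt (((continuous_stdSimplex_apply i).tendsto z).comp hz)
      ((stdSimplex.zero_le z i).lt_of_ne' hzi)
  have hdist : ∀ᶠ m in atTop, dist (x (n m)) z + 1 / ((n m : ℝ) + 1) < δ :=
    ((tendsto_iff_dist_tendsto_zero.1 hz).add hε).eventually_lt_const (by simpa using hδ)
  obtain ⟨m, hm, hmδ⟩ := (hpos.and hdist).exists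
  obtain ⟨y, hy, hxy⟩ := (hx (n m) i).resolve_left hm.not_ge
  refine ⟨y, hy, (dist_triangle_left z y (x (n m))).trans_lt (hmδ.trans_le' ?_)⟩
  gcongr

/-- **Gale–Nikaido–Debreu lemma**: the sets where `φ i` is largest form a closed cover. -/
theorem exists_forall_nonpos_of_sum_mul_nonpos {φ : I → stdSimplex ℝ I → ℝ}
    (hφ : ∀ i, Continuous (φ i)) (hsum : ∀ w, ∑ i, w i * φ i w ≤ 0) :
    ∃ w, ∀ i, φ i w ≤ 0 := by
  obtain ⟨w, hw⟩ := exists_forall_eq_zero_or_mem_of_isClosed_cover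
    (F := fun i => {w | ∀ j, φ j w ≤ φ i w})
    (fun i => by
      simpa only [Set.ofPred_forall] using isClosed_iInter fun j => isClosed_le (hφ j) (hφ i))
    (fun w => Finite.exists_max fun i => φ i w)
  refine ⟨w, fun j => (hsum w).trans' ?_⟩
  calc φ j w = ∑ i, w i * φ j w := by rw [← Finset.sum_mul, stdSimplex.sum_eq_one, one_mul]
    _ ≤ ∑ i, w i * φ i w := Finset.sum_le_sum fun i _ => by
      rcases hw i with hi | hi
      · simp only [hi, zero_mul, le_refl]
      · exact mul_le_mul_of_nonneg_left (hi j) (stdSimplex.zero_le w i)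

end Covering

section Mixture

variable {ι J : Type*} [Fintype ι] [Fintype J]

/-- The convex combination of the distributions `x i` with weights `w i`. -/
noncomputable def mixture (w : stdSimplex ℝ ι) (x : ι → stdSimplex ℝ J) : stdSimplex ℝ J :=
  ⟨∑ i, w i • ⇑(x i), (convex_stdSimplex ℝ J).sum_mem (fun i _ => stdSimplex.zero_le w i)
    (stdSimplex.sum_eq_one w) fun i _ => (x i).2⟩

theorem mixture_apply (w : stdSimplex ℝ ι) (x : ι → stdSimplex ℝ J) (j : J) :
    mixture w x j = ∑ i, w i * x i j :=
  Finset.sum_apply j _ _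

theorem continuous_mixture (x : ι → stdSimplex ℝ J) : Continuous fun w => mixture w x :=
  Continuous.subtype_mk (continuous_finsetSum _ fun i _ =>
    (continuous_stdSimplex_apply i).smul continuous_const) _

end Mixture

namespace MinGame

variable {P : Type*} [Fintype P] [DecidableEq P] {k : ℕ} {G : MinGame P k}
  [∀ p, Fintype (G.S p)] {ι : Type*} [Fintype ι]

theorem law_apply (σ : G.Play) (s : ∀ p, G.S p) : law σ s = ∏ p, σ p (s p) :=
  rfl

theorem law_update_apply (σ : G.Play) (p : P) (τ : G.MixedStrategy p) (s : ∀ p, G.S p) :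
    law (Function.update σ p τ) s = τ (s p) * ∏ q ∈ Finset.univ.erase p, σ q (s q) := by
  rw [law_apply, ← Finset.mul_prod_erase _ _ (Finset.mem_univ p), Function.update_self]
  congr 1
  exact Finset.prod_congr rfl fun q hq => by
    rw [Function.update_of_ne (Finset.ne_of_mem_erase hq)]

theorem expectation_eq_sum (σ : G.Play) (f : (∀ p, G.S p) → ℝ) :
    expectation σ f = ∑ s, law σ s * f s :=
  rfl

theorem expectation_update_mixture (σ : G.Play) (p : P) (w : stdSimplex ℝ ι)
    (τ : ι → G.MixedStrategy p) (f : (∀ p, G.S p) → ℝ) :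
    expectation (Function.update σ p (mixture w τ)) f =
      ∑ i, w i * expectation (Function.update σ p (τ i)) f := by
  simp only [expectation_eq_sum, law_update_apply, mixture_apply, Finset.sum_mul, Finset.mul_sum]
  rw [Finset.sum_comm]
  simp only [mul_assoc]

theorem continuous_expectation (f : (∀ p, G.S p) → ℝ) :
    Continuous fun σ : G.Play => expectation σ f :=
  continuous_finsetSum _ fun s _ => .mul (continuous_finsetProd _ fun p _ =>
    (continuous_stdSimplex_apply (s p)).comp (continuous_apply p)) continuous_const

variable [NeZero k]

theorem continuous_payoff (p : P) : Continuous fun σ : G.Play => payoff σ p :=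
  Continuous.finset_inf'_apply _ fun i _ => continuous_expectation (G.u p i)

theorem sum_mul_payoff_update_le (σ : G.Play) (p : P) (w : stdSimplex ℝ ι)
    (τ : ι → G.MixedStrategy p) :
    ∑ i, w i * payoff (Function.update σ p (τ i)) p ≤
      payoff (Function.update σ p (mixture w τ)) p := by
  refine Finset.le_inf' _ _ fun j hj => ?_
  rw [expectation_update_mixture]
  exact Finset.sum_le_sum fun i _ =>
    mul_le_mul_of_nonneg_left (Finset.inf'_le _ hj) (stdSimplex.zero_le w i)

/-- The sum over the players of what each of them gains by switching alone from `σ` to `τ`; a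
play is an equilibrium when no `τ` has positive total gain against it. -/
noncomputable def totalGain (σ τ : G.Play) : ℝ :=
  ∑ p, (payoff (Function.update σ p (τ p)) p - payoff σ p)

theorem continuous_totalGain (τ : G.Play) : Continuous fun σ : G.Play => totalGain σ τ :=
  continuous_finsetSum _ fun p _ => ((continuous_payoff p).comp
    (continuous_id.update p continuous_const)).sub (continuous_payoff p)

theorem totalGain_self (σ : G.Play) : totalGain σ σ = 0 :=
  Finset.sum_eq_zero fun p _ => by rw [Function.update_eq_self, sub_self]

theorem totalGain_update (σ : G.Play) (p : P) (τ : G.MixedStrategy p) :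
    totalGain σ (Function.update σ p τ) = payoff (Function.update σ p τ) p - payoff σ p := by
  rw [totalGain, Fintype.sum_eq_single p, Function.update_self]
  intro q hq
  rw [Function.update_of_ne hq, Function.update_eq_self, sub_self]

theorem sum_mul_totalGain_le (σ : G.Play) (w : stdSimplex ℝ ι) (ρ : ι → G.Play) :
    ∑ i, w i * totalGain σ (ρ i) ≤ totalGain σ fun p => mixture w fun i => ρ i p := by
  simp only [totalGain, Finset.mul_sum]
  rw [Finset.sum_comm]
  refine Finset.sum_le_sum fun p _ => ?_
  simp only [mul_sub, Finset.sum_sub_distrib]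
  rw [← Finset.sum_mul, stdSimplex.sum_eq_one, one_mul]
  exact sub_le_sub_right (sum_mul_payoff_update_le σ p w _) _

theorem exists_forall_totalGain_nonpos_of_finite {ι : Type*} [Finite ι] [Nonempty ι]
    (ρ : ι → G.Play) : ∃ σ, ∀ i, totalGain σ (ρ i) ≤ 0 := by
  cases nonempty_fintype ι
  let σ : stdSimplex ℝ ι → G.Play := fun w p => mixture w fun i => ρ i p
  have hσ : Continuous σ := continuous_pi fun p => continuous_mixture _
  obtain ⟨w, hw⟩ := exists_forall_nonpos_of_sum_mul_nonpos
    (fun i => (continuous_totalGain (ρ i)).comp hσ)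
    (fun w => (sum_mul_totalGain_le (σ w) w ρ).trans_eq (totalGain_self (σ w)))
  exact ⟨σ w, hw⟩

theorem exists_forall_totalGain_nonpos [∀ p, Nonempty (G.S p)] :
    ∃ σ : G.Play, ∀ τ, totalGain σ τ ≤ 0 := by
  by_contra! hgain
  obtain ⟨t, ht⟩ := isCompact_univ.elim_finite_subcover (fun τ : G.Play => {σ | 0 < totalGain σ τ})
    (fun τ => isOpen_lt continuous_const (continuous_totalGain τ))
    fun σ _ => Set.mem_iUnion.2 (hgain σ)
  have hcover : ∀ σ, ∃ τ : t, 0 < totalGain σ τ.1 := by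
    simpa [Set.subset_def] using ht
  have : Nonempty t := (hcover (Classical.arbitrary _)).nonempty
  obtain ⟨σ, hσ⟩ := exists_forall_totalGain_nonpos_of_finite fun τ : t => τ.1
  obtain ⟨τ, hτ⟩ := hcover σ
  exact hτ.not_ge (hσ τ)

end MinGame

theorem mainTheorem1 {P : Type*} [Fintype P] [DecidableEq P] {k : ℕ} [NeZero k]
    (G : MinGame P k) [∀ p, Fintype (G.S p)] [∀ p, Nonempty (G.S p)] :
    ∃ σ : G.Play, MinGame.IsEquilibrium σ := by
  obtain ⟨σ, hσ⟩ := MinGame.exists_forall_totalGain_nonpos (G := G)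
  refine ⟨σ, fun p τ => sub_nonpos.1 ?_⟩
  rw [← MinGame.totalGain_update]
  exact hσ (Function.update σ p τ)
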